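/- Let $L/K$ be a cyclic extension of number fields, i.e. a Galois extension with cyclic Galois group. Let $\mathbb{I}_K=\mathbb{A}_K^\times$ and $\mathbb{I}_L=\mathbb{A}_L^\times$ be the idele groups, let $K^*$ be embedded diagonally in $\mathbb{I}_K$, and let $N:\mathbb{I}_L\to\mathbb{I}_K$ be the idele norm, given at every finite or infinite place $w$ of $K$ by $$N(x)_w=\prod_{v\mid w}N_{L_v/K_w}(x_v),$$ the product over the places $v$ of $L$ above $w$. Then the subgroup $K^*N(\mathbb{I}_L)$ has finite index in $\mathbb{I}_K$: $$[\mathbb{I}_K:K^*N(\mathbb{I}_L)]<\infty .$$ -/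

import Mathlib

noncomputable section

namespace NormIndex

open NumberField IsDedekindDomain IsDedekindDomain.HeightOneSpectrum

variable {K L : Type*} [Field K] [NumberField K] [Field L] [NumberField L] [Algebra K L]

/-! ### Finite places: the extension of completions `L_w / K_v` and its norm -/

section FinitePlaces

variable (v : HeightOneSpectrum (𝓞 K)) (w : HeightOneSpectrum (𝓞 L))
  [w.asIdeal.LiesOver v.asIdeal]

/-- For a prime `w` of `L` above the prime `v` of `K`, the ring homomorphism `K_v → L_w` which
extends `K → L` by continuity. -/
def finiteCompletionMap : v.adicCompletion K →+* w.adicCompletion L :=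
  ((adicCompletion.equiv L w).symm.toRingHom.comp
    (UniformSpace.Completion.mapRingHom
      (algebraMap (WithVal (v.valuation K)) (WithVal (w.valuation L)))
      (uniformContinuous_algebraMap_liesOver K L v w).continuous)).comp
    (adicCompletion.equiv K v).toRingHom

theorem continuous_finiteCompletionMap : Continuous (finiteCompletionMap v w) :=
  (adicCompletion.continuous_ofCompletion L w).comp <|
    UniformSpace.Completion.continuous_map.comp (adicCompletion.continuous_toCompletion K v)

theorem finiteCompletionMap_algebraMap (x : K) :
    finiteCompletionMap v w (algebraMap K (v.adicCompletion K) x) =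
      algebraMap L (w.adicCompletion L) (algebraMap K L x) := by
  apply adicCompletion.ext
  exact UniformSpace.Completion.mapRingHom_coe
    (uniformContinuous_algebraMap_liesOver K L v w).continuous (WithVal.toVal (v.valuation K) x)

/-- `L_w` as a `K_v`-algebra. -/
abbrev finiteCompletionAlgebra : Algebra (v.adicCompletion K) (w.adicCompletion L) :=
  (finiteCompletionMap v w).toAlgebra

/-- The local norm `N_{L_w / K_v} : L_w → K_v` at a finite place. -/
def finiteLocalNorm : w.adicCompletion L →* v.adicCompletion K :=
  letI := finiteCompletionAlgebra v w
  Algebra.norm (v.adicCompletion K)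

theorem finite_finiteCompletionAlgebra :
    letI := finiteCompletionAlgebra v w
    Module.Finite (v.adicCompletion K) (w.adicCompletion L) := by
  let _ := finiteCompletionAlgebra v w
  have : ContinuousSMul (v.adicCompletion K) (w.adicCompletion L) :=
    ⟨((continuous_finiteCompletionMap v w).comp continuous_fst).mul continuous_snd⟩
  have : IsScalarTower K (v.adicCompletion K) (w.adicCompletion L) :=
    .of_algebraMap_eq fun x ↦ by
      rw [RingHom.algebraMap_toAlgebra, finiteCompletionMap_algebraMap]
      exact IsScalarTower.algebraMap_apply K L (w.adicCompletion L) x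
  infer_instance

open scoped Valued in
theorem continuous_finiteLocalNorm : Continuous (finiteLocalNorm v w) := by
  let _ := finiteCompletionAlgebra v w
  have : ContinuousSMul (v.adicCompletion K) (w.adicCompletion L) :=
    ⟨((continuous_finiteCompletionMap v w).comp continuous_fst).mul continuous_snd⟩
  have := finite_finiteCompletionAlgebra v w
  let b := Module.finBasis (v.adicCompletion K) (w.adicCompletion L)
  have h : (finiteLocalNorm v w : w.adicCompletion L → v.adicCompletion K) =
      fun x ↦ (Algebra.leftMulMatrix b x).det :=
    funext fun x ↦ Algebra.norm_eq_matrix_det b x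
  rw [h]
  refine Continuous.matrix_det ?_
  exact LinearMap.continuous_of_finiteDimensional (Algebra.leftMulMatrix b).toLinearMap

theorem finiteLocalNorm_mem_integers {x : w.adicCompletion L}
    (hx : x ∈ w.adicCompletionIntegers L) :
    finiteLocalNorm v w x ∈ v.adicCompletionIntegers K := by
  have h0 : finiteLocalNorm v w 0 = 0 := by
    let _ := finiteCompletionAlgebra v w
    have := finite_finiteCompletionAlgebra v w
    exact Algebra.norm_zero
  have hU : finiteLocalNorm v w ⁻¹' (v.adicCompletionIntegers K : Set (v.adicCompletion K)) ∈
      nhds 0 := by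
    refine (continuous_finiteLocalNorm v w).continuousAt.preimage_mem_nhds ?_
    rw [h0]
    exact (Valued.isOpen_valuationSubring _).mem_nhds (zero_mem _)
  -- a nonzero `c` such that `c * O_w` is mapped into `O_v`
  obtain ⟨c, hc0, hc⟩ : ∃ c : w.adicCompletion L, c ≠ 0 ∧ ∀ y ∈ w.adicCompletionIntegers L,
      finiteLocalNorm v w (c * y) ∈ v.adicCompletionIntegers K := by
    obtain ⟨γ, hγ⟩ := (Valued.mem_nhds_zero).1 hU
    obtain ⟨r, s, hr, hs, hrs⟩ := Valuation.restrict_exists_div_eq Valued.v γ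
    rw [← map_div₀] at hrs
    obtain ⟨p, hp⟩ := valuedAdicCompletion_surjective L w (WithZero.exp (-1))
    have hp1 : Valued.v p < 1 := by
      rw [hp, ← WithZero.exp_zero, WithZero.exp_lt_exp]
      norm_num
    have hp0 : p ≠ 0 := by
      rintro rfl
      rw [map_zero] at hp
      exact WithZero.exp_ne_zero hp.symm
    have hrs0 : 0 < Valued.v (r / s) := by
      rw [map_div₀]
      exact div_pos hr hs
    refine ⟨p * (r / s), mul_ne_zero hp0 ((Valuation.pos_iff _).1 hrs0), fun y hy ↦ hγ ?_⟩
    change Valued.v.restrict (p * (r / s) * y) < γ.1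
    rw [← hrs, Valuation.restrict_lt_iff, mul_right_comm, map_mul, map_mul]
    refine mul_lt_of_lt_one_left hrs0 ?_
    exact mul_lt_one_of_lt_of_le hp1 ((mem_adicCompletionIntegers _ _ _).1 hy)
  have hNc : finiteLocalNorm v w c ≠ 0 := ((Units.mk0 c hc0).isUnit.map (finiteLocalNorm v w)).ne_zero
  by_contra hN
  rw [mem_adicCompletionIntegers, not_le] at hN
  obtain ⟨n, hn⟩ := MulArchimedean.arch (Valued.v (finiteLocalNorm v w c))⁻¹ hN
  have h1 := hc (x ^ (n + 1)) (pow_mem hx _)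
  rw [map_mul, map_pow, mem_adicCompletionIntegers, map_mul, map_pow] at h1
  have hpos : 0 < Valued.v (finiteLocalNorm v w c) := by
    simpa [zero_lt_iff] using hNc
  rw [inv_le_iff_one_le_mul₀ hpos] at hn
  rw [pow_succ, ← mul_assoc, mul_comm (Valued.v (finiteLocalNorm v w c))] at h1
  exact absurd (lt_of_lt_of_le hN (le_mul_of_one_le_left' hn)) (not_lt.2 h1)

/-- There are only finitely many primes of `L` above a prime `v` of `K`. -/
theorem finite_primesAbove (v : HeightOneSpectrum (𝓞 K)) :
    Finite {w : HeightOneSpectrum (𝓞 L) // w.asIdeal.LiesOver v.asIdeal} := by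
  have := v.isMaximal
  have : Finite (v.asIdeal.primesOver (𝓞 L)) :=
    (IsDedekindDomain.primesOver_finite v.asIdeal (𝓞 L)).to_subtype
  refine Finite.of_injective
    (fun w ↦ (⟨w.1.asIdeal, w.1.isPrime, w.2⟩ : v.asIdeal.primesOver (𝓞 L))) fun w w' h ↦ ?_
  exact Subtype.ext (HeightOneSpectrum.ext (congrArg Subtype.val h))

instance (v : HeightOneSpectrum (𝓞 K)) :
    Fintype {w : HeightOneSpectrum (𝓞 L) // w.asIdeal.LiesOver v.asIdeal} :=
  have := finite_primesAbove (L := L) v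
  Fintype.ofFinite _

end FinitePlaces

section Infinite

variable (v : InfinitePlace K) (w : InfinitePlace L) [w.LiesOver v]

open scoped NumberField.LiesOver in
/-- The local norm `N_{L_w / K_v} : L_w → K_v` at an infinite place, for the `K_v`-algebra
structure on `L_w` which extends `K → L` by continuity. -/
def infiniteLocalNorm : w.Completion →* v.Completion :=
  Algebra.norm v.Completion

end Infinite

/-! ### The idele norm -/

variable (K L)

open scoped Classical in
/-- The norm on infinite adeles: `N(x)_v = ∏_{w ∣ v} N_{L_w / K_v}(x_w)`. -/
def infiniteAdeleNorm : InfiniteAdeleRing L →* InfiniteAdeleRing K where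
  toFun x v := ∏ w : {w : InfinitePlace L // w.LiesOver v},
    haveI := w.2
    infiniteLocalNorm v w.1 (x w.1)
  map_one' := funext fun v ↦ Finset.prod_eq_one fun w _ ↦ map_one _
  map_mul' x y := funext fun v ↦ by
    refine Eq.trans (Finset.prod_congr rfl fun w _ ↦ ?_) Finset.prod_mul_distrib
    exact map_mul _ _ _

variable {K} in
/-- The component at a finite place `v` of the norm on finite adeles:
`N(x)_v = ∏_{w ∣ v} N_{L_w / K_v}(x_w)`. -/
def finiteAdeleNormAt (v : HeightOneSpectrum (𝓞 K)) :
    FiniteAdeleRing (𝓞 L) L →* v.adicCompletion K where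
  toFun x := ∏ w : {w : HeightOneSpectrum (𝓞 L) // w.asIdeal.LiesOver v.asIdeal},
    haveI := w.2
    finiteLocalNorm v w.1 (x w.1)
  map_one' := Finset.prod_eq_one fun w _ ↦ map_one _
  map_mul' x y := by
    refine Eq.trans (Finset.prod_congr rfl fun w _ ↦ ?_) Finset.prod_mul_distrib
    exact map_mul _ _ _

theorem eventually_finiteAdeleNormAt_mem (x : FiniteAdeleRing (𝓞 L) L) :
    ∀ᶠ v : HeightOneSpectrum (𝓞 K) in Filter.cofinite,
      finiteAdeleNormAt L v x ∈ v.adicCompletionIntegers K := by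
  have hfin : {w : HeightOneSpectrum (𝓞 L) | x w ∉ w.adicCompletionIntegers L}.Finite := x.2
  refine (hfin.image (fun w ↦ w.under (𝓞 K))).subset fun v hv ↦ ?_
  by_contra hv'
  refine hv (show finiteAdeleNormAt L v x ∈ v.adicCompletionIntegers K from
    prod_mem fun w _ ↦ ?_)
  have := w.2
  refine finiteLocalNorm_mem_integers v w.1 ?_
  by_contra hw
  exact hv' ⟨w.1, hw, HeightOneSpectrum.ext w.2.over.symm⟩

/-- The norm on finite adeles. -/
def finiteAdeleNorm : FiniteAdeleRing (𝓞 L) L →* FiniteAdeleRing (𝓞 K) K where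
  toFun x := ⟨fun v ↦ finiteAdeleNormAt L v x, eventually_finiteAdeleNormAt_mem K L x⟩
  map_one' := FiniteAdeleRing.ext K fun v ↦ map_one (finiteAdeleNormAt L v)
  map_mul' x y := FiniteAdeleRing.ext K fun v ↦ map_mul (finiteAdeleNormAt L v) x y

/-- The group of ideles of `K`. -/
abbrev Ideles (K : Type*) [Field K] [NumberField K] : Type _ := (AdeleRing (𝓞 K) K)ˣ

/-- The idele norm `N : 𝕀_L → 𝕀_K`, `N(x)_v = ∏_{w ∣ v} N_{L_w / K_v}(x_w)` at every finite or
infinite place `v` of `K`. -/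
def ideleNorm : Ideles L →* Ideles K :=
  Units.map ((infiniteAdeleNorm K L).prodMap (finiteAdeleNorm K L))

/-- The diagonally embedded subgroup `K^*` of the idele group of `K`. -/
def principalIdeles : Subgroup (Ideles K) :=
  (Units.map (algebraMap K (AdeleRing (𝓞 K) K)).toMonoidHom).range

/-- The subgroup `K^* N(𝕀_L)` of `𝕀_K`. -/
def normSubgroup : Subgroup (Ideles K) :=
  principalIdeles K ⊔ (ideleNorm K L).range

end NormIndex

end

/-! Let `U` be the ideles that are units at all finite places, and `H` the norm subgroup. Finiteness
of the class group bounds the index of `K^* U`, so it is enough that `H ∩ U` has finite index in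
`U`: this bounds the index of `H` in `H U`, which contains `K^* U`.

This second finiteness is local. Write `n = [L : K]`, and call a finite place bad if it ramifies or
divides `n!`; there are finitely many such places. At a good place every unit is a norm of a unit
(`exists_finiteLocalNorm_eq`): lift a norm from the residue extension, then correct by a power
obtained from Hensel's lemma. At a bad place, `n!`-th powers of units are norms of units because the
local degree divides `n!`, and they have finite index in the compact group of units. At an infinite
place squares are norms and have index at most 2. So `powerIdeles` has finite index in `U` and
consists of norms; only one place of `L` above each place of `K` is needed. -/

noncomputable section

namespace NormIndex

open NumberField IsDedekindDomain IsDedekindDomain.HeightOneSpectrum IsLocalRing Module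

/-! ### Norms of units in unramified extensions of complete local rings -/

section LocalRings

variable {R S : Type*} [CommRing R] [CommRing S] [Algebra R S] [IsLocalRing R]

attribute [local instance] Ideal.Quotient.field

/-- The norm of a finite free algebra over a local ring commutes with reduction. -/
theorem norm_quotient_mk [Module.Free R S] [Module.Finite R S] (x : S) :
    Algebra.norm (R ⧸ maximalIdeal R)
      (Ideal.Quotient.mk ((maximalIdeal R).map (algebraMap R S)) x) =
      Ideal.Quotient.mk (maximalIdeal R) (Algebra.norm R x) := by
  classical
  let b : Basis (Free.ChooseBasisIndex R S) R S := Free.chooseBasis R S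
  rw [Algebra.norm_eq_matrix_det b,
    Algebra.norm_eq_matrix_det (IsLocalRing.basisQuotient b), RingHom.map_det]
  congr 1
  ext i j
  simp only [Algebra.leftMulMatrix_apply, Algebra.coe_lmul_eq_mul, LinearMap.toMatrix_apply,
    IsLocalRing.basisQuotient_apply, LinearMap.mul_apply', Matrix.map_apply, ← map_mul,
    IsLocalRing.basisQuotient_repr, RingHom.mapMatrix_apply]

/-- In a complete local ring, every element congruent to `1` is a `d`-th power if `d` is
invertible. -/
theorem exists_pow_eq_of_sub_one_mem [IsAdicComplete (maximalIdeal R) R] {d : ℕ}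
    (hd : IsUnit (d : R)) {u : R} (hu : u - 1 ∈ maximalIdeal R) : ∃ z : R, z ^ d = u := by
  have hd0 : d ≠ 0 := by
    rintro rfl
    simp at hd
  -- Hensel's lemma for `X ^ d - u` at the approximate root `1`, where the derivative is the unit
  -- `d`.
  obtain ⟨z, hz, -⟩ := HenselianRing.is_henselian (I := maximalIdeal R)
    (Polynomial.X ^ d - Polynomial.C u) (Polynomial.monic_X_pow_sub_C u hd0) 1
    (by simpa using neg_mem hu) (by
      rw [Polynomial.derivative_sub, Polynomial.derivative_X_pow, Polynomial.derivative_C]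
      simpa using hd.map (Ideal.Quotient.mk (maximalIdeal R)))
  exact ⟨z, by simpa [Polynomial.IsRoot, sub_eq_zero] using hz⟩

/-- The norm of a tamely unramified extension of complete local rings with finite residue fields is
surjective on units. -/
theorem exists_norm_eq_of_unramified [IsLocalRing S] [Module.Free R S] [Module.Finite R S]
    [IsAdicComplete (maximalIdeal R) R] [Finite (ResidueField R)]
    (hS : (maximalIdeal R).map (algebraMap R S) = maximalIdeal S)
    (hd : IsUnit (finrank R S : R)) {u : R} (hu : IsUnit u) :
    ∃ y : S, IsUnit y ∧ Algebra.norm R y = u := by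
  have hmax : ((maximalIdeal R).map (algebraMap R S)).IsMaximal := hS ▸ inferInstance
  have : Finite (R ⧸ maximalIdeal R) := ‹Finite (ResidueField R)›
  have : Module.Finite (R ⧸ maximalIdeal R) (S ⧸ (maximalIdeal R).map (algebraMap R S)) :=
    .of_restrictScalars_finite R _ _
  have : Finite (S ⧸ (maximalIdeal R).map (algebraMap R S)) :=
    Module.finite_of_finite (R ⧸ maximalIdeal R)
  -- Norms between finite fields are surjective, so `u` is a norm modulo the maximal ideal.
  obtain ⟨t, ht⟩ := FiniteField.norm_surjective (R ⧸ maximalIdeal R)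
    (S ⧸ (maximalIdeal R).map (algebraMap R S)) (Ideal.Quotient.mk _ u)
  obtain ⟨y, rfl⟩ := Ideal.Quotient.mk_surjective t
  rw [norm_quotient_mk] at ht
  have hNy : IsUnit (Algebra.norm R y) := by
    by_contra h
    rw [Ideal.Quotient.eq_zero_iff_mem.2 ((mem_maximalIdeal _).2 h), eq_comm,
      Ideal.Quotient.eq_zero_iff_mem] at ht
    exact (mem_maximalIdeal _).1 ht hu
  have hy : IsUnit y := by
    by_contra h
    rw [← norm_quotient_mk, Ideal.Quotient.eq_zero_iff_mem.2 (hS ▸ (mem_maximalIdeal _).2 h),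
      Algebra.norm_zero, eq_comm, Ideal.Quotient.eq_zero_iff_mem] at ht
    exact (mem_maximalIdeal _).1 ht hu
  obtain ⟨c, hc⟩ := hNy
  -- The error `u / N(y)` is congruent to `1`, hence equal to `z ^ finrank R S`, which is the norm
  -- of `z`.
  obtain ⟨z, hz⟩ := exists_pow_eq_of_sub_one_mem hd (u := u * ↑c⁻¹) (by
    have : u * ↑c⁻¹ - 1 = (u - Algebra.norm R y) * ↑c⁻¹ := by rw [← hc]; simp [sub_mul]
    rw [this]
    exact Ideal.mul_mem_right _ _ (Ideal.Quotient.eq.1 ht.symm))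
  have hd0 : finrank R S ≠ 0 := by
    intro h
    simp [h] at hd
  have hzu : IsUnit z := by
    rw [← isUnit_pow_iff hd0, hz]
    exact hu.mul c⁻¹.isUnit
  refine ⟨algebraMap R S z * y, (hzu.map _).mul hy, ?_⟩
  rw [map_mul, Algebra.norm_algebraMap_of_basis (Free.chooseBasis R S),
    ← finrank_eq_card_chooseBasisIndex, hz, ← hc]
  simp

end LocalRings

/-! ### Topology and arithmetic of the completion at a finite place -/

section Completion

variable {K : Type*} [Field K] [NumberField K] (v : HeightOneSpectrum (𝓞 K))

theorem mem_maximalIdeal_adicCompletionIntegers_iff (x : v.adicCompletionIntegers K) :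
    x ∈ maximalIdeal (v.adicCompletionIntegers K) ↔ Valued.v (x : v.adicCompletion K) < 1 := by
  rw [mem_maximalIdeal, mem_nonunits_iff, adicCompletionIntegers.isUnit_iff_valued_eq_one]
  exact ((mem_adicCompletionIntegers _ _ _).1 x.2).lt_iff_ne.symm

theorem valued_algebraMap (y : K) :
    Valued.v (algebraMap K (v.adicCompletion K) y) = v.valuation K y :=
  valuedAdicCompletion_eq_valuation' v y

theorem isOpen_setOf_valued_sub_lt (x : v.adicCompletion K) {γ : WithZero (Multiplicative ℤ)}
    (hγ : γ ≠ 0) : IsOpen {z : v.adicCompletion K | Valued.v (x - z) < γ} := by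
  obtain ⟨g, hg⟩ := valuedAdicCompletion_surjective K v γ
  have hg0 : g ≠ 0 := by
    rintro rfl
    exact hγ (by simpa using hg.symm)
  rw [isOpen_iff_mem_nhds]
  intro z hz
  rw [Valued.mem_nhds]
  refine ⟨Units.mk0 (Valued.v.restrict g) (by simpa using hg0), fun t ht ↦ ?_⟩
  have ht : Valued.v (t - z) < γ := by
    rw [← hg]
    simpa using ht
  have := Valued.v.map_sub (x - z) (t - z)
  rw [sub_sub_sub_cancel_right] at this
  exact this.trans_lt (max_lt hz ht)

theorem exists_valued_sub_lt (x : v.adicCompletion K) {γ : WithZero (Multiplicative ℤ)}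
    (hγ : γ ≠ 0) :
    ∃ y : K, Valued.v (x - algebraMap K (v.adicCompletion K) y) < γ :=
  (denseRange_algebraMap K v).exists_mem_open (isOpen_setOf_valued_sub_lt v x hγ)
    ⟨x, by simpa using hγ.bot_lt⟩

/-- A neighbourhood of a point of `K_v` contains a ball around it. -/
theorem exists_valued_sub_le_subset {x : v.adicCompletion K} {s : Set (v.adicCompletion K)}
    (hs : s ∈ nhds x) : ∃ c : v.adicCompletion K, c ≠ 0 ∧ ∀ y, Valued.v (y - x) ≤ Valued.v c →
      y ∈ s := by
  obtain ⟨γ, hγ⟩ := (Valued.mem_nhds).1 hs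
  obtain ⟨r, s, hr, hs, hrs⟩ := Valuation.restrict_exists_div_eq Valued.v γ
  rw [← map_div₀] at hrs
  obtain ⟨p, hp⟩ := valuedAdicCompletion_surjective K v (WithZero.exp (-1))
  have hp1 : Valued.v p < 1 := by
    rw [hp, ← WithZero.exp_zero, WithZero.exp_lt_exp]
    norm_num
  have hp0 : p ≠ 0 := by
    rintro rfl
    rw [map_zero] at hp
    exact WithZero.exp_ne_zero hp.symm
  have hrs0 : 0 < Valued.v (r / s) := by
    rw [map_div₀]
    exact div_pos hr hs
  -- `r / s` realises the radius `γ`; the factor `p` makes the closed ball fit in the open one.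
  refine ⟨p * (r / s), mul_ne_zero hp0 ((Valuation.pos_iff _).1 hrs0), fun y hy ↦ hγ ?_⟩
  change Valued.v.restrict (y - x) < γ.1
  rw [← hrs, Valuation.restrict_lt_iff]
  refine hy.trans_lt ?_
  rw [map_mul]
  exact mul_lt_of_lt_one_left hrs0 hp1

/-- By density of `K`, and then approximation by global integers, the finite ring `𝓞 K ⧸ v.asIdeal`
surjects onto this field. -/
instance finite_residueField_adicCompletionIntegers :
    Finite (ResidueField (v.adicCompletionIntegers K)) := by
  have : Finite (𝓞 K ⧸ v.asIdeal) := v.asIdeal.finiteQuotientOfFreeOfNeBot v.ne_bot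
  have hval (a : 𝓞 K) : Valued.v (algebraMap (𝓞 K) (v.adicCompletionIntegers K) a :
      v.adicCompletion K) = v.valuation K (algebraMap (𝓞 K) K a) := valued_algebraMap v _
  let f : 𝓞 K ⧸ v.asIdeal →+* ResidueField (v.adicCompletionIntegers K) :=
    Ideal.Quotient.lift v.asIdeal
      ((residue _).comp (algebraMap (𝓞 K) (v.adicCompletionIntegers K))) fun a ha ↦ by
        rw [RingHom.comp_apply, residue_eq_zero_iff, mem_maximalIdeal_adicCompletionIntegers_iff,
          hval]
        exact (valuation_lt_one_iff_mem v a).2 ha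
  refine Finite.of_surjective f fun t ↦ ?_
  obtain ⟨x, rfl⟩ := residue_surjective t
  obtain ⟨y, hy⟩ := exists_valued_sub_lt v (x : v.adicCompletion K) one_ne_zero
  have hy1 : v.valuation K y ≤ 1 := by
    rw [← valued_algebraMap, ← sub_sub_cancel (x : v.adicCompletion K) (algebraMap K _ y)]
    exact (Valued.v.map_sub _ _).trans (max_le ((mem_adicCompletionIntegers _ _ _).1 x.2) hy.le)
  obtain ⟨a, ha⟩ := exists_valuation_sub_lt_of_integer v hy1 1
  refine ⟨Ideal.Quotient.mk _ a, ?_⟩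
  change residue _ (algebraMap (𝓞 K) (v.adicCompletionIntegers K) a) = _
  rw [← sub_eq_zero, ← map_sub, residue_eq_zero_iff, mem_maximalIdeal_adicCompletionIntegers_iff]
  rw [← valued_algebraMap, map_sub] at ha
  rw [Valuation.map_sub_swap] at hy
  have h := (Valued.v.map_add _ _).trans_lt (max_lt ha hy)
  rw [sub_add_sub_cancel] at h
  exact h

instance compactSpace_adicCompletionIntegers : CompactSpace (v.adicCompletionIntegers K) := by
  have : CompactSpace (Valued.integer (v.adicCompletion K)) := by
    open Valued.integer in
    refine compactSpace_iff_completeSpace_and_isDiscreteValuationRing_and_finite_residueField.2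
      ⟨?_, ?_, ?_⟩
    · exact (Valued.isClosed_integer (v.adicCompletion K)).completeSpace_coe
    · exact inferInstanceAs (IsDiscreteValuationRing (v.adicCompletionIntegers K))
    · exact finite_residueField_adicCompletionIntegers v
  exact this

-- The cosets `f n + 𝔪 ^ n` of a Cauchy sequence are nested, closed and nonempty in a compact space;
-- a common point is a limit.
open scoped Pointwise in
instance isAdicComplete_adicCompletionIntegers :
    IsAdicComplete (maximalIdeal (v.adicCompletionIntegers K)) (v.adicCompletionIntegers K) where
  prec' f hf := by
    let S n : Set (v.adicCompletionIntegers K) :=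
      f n +ᵥ ((maximalIdeal (v.adicCompletionIntegers K) ^ n : Ideal _) : Set _)
    have hS n : S (n + 1) ⊆ S n := by
      apply (Set.vadd_set_subset_vadd_set_iff.mpr (Ideal.pow_le_pow_right n.le_succ)).trans
      simpa [S] using (hf n.le_succ).symm
    have h n : IsClosed (S n) := (IsNoetherianRing.isClosed_ideal (_ ^ n)).vadd (f n)
    obtain ⟨L, hL⟩ := (h 0).isCompact.nonempty_iInter_of_sequence_nonempty_isCompact_isClosed S hS
      (by simp [S]) h
    refine ⟨L, fun n ↦ ?_⟩
    obtain ⟨y, hy, rfl⟩ := Set.mem_iInter.mp hL n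
    simpa [SModEq.sub_mem] using hy

open scoped Valued in
/-- The `d`-th powers of units have finite index in the units of `O_v`. -/
theorem finiteIndex_range_powMonoidHom {d : ℕ} (hd : d ≠ 0) :
    (powMonoidHom d : (v.adicCompletionIntegers K)ˣ →* _).range.FiniteIndex := by
  have : CharZero (v.adicCompletion K) := charZero_of_injective_algebraMap
    (algebraMap K (v.adicCompletion K)).injective
  -- The derivative `d` at `1` is nonzero in characteristic zero, so the power map sends
  -- neighbourhoods of `1` to neighbourhoods of `1`. The powers thus form an open subgroup of a
  -- compact group.
  have hder : HasStrictDerivAt (fun x : v.adicCompletion K ↦ x ^ d)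
      ((d : v.adicCompletion K) * 1 ^ (d - 1)) 1 := hasStrictDerivAt_pow d 1
  have hmap := hder.map_nhds_eq (by simpa using hd)
  rw [one_pow] at hmap
  have hU : {z : v.adicCompletion K | Valued.v (1 - z) < 1} ∈ nhds 1 :=
    (isOpen_setOf_valued_sub_lt v 1 one_ne_zero).mem_nhds (by simp)
  have hopen : IsOpen ((powMonoidHom d : (v.adicCompletionIntegers K)ˣ →* _).range :
      Set (v.adicCompletionIntegers K)ˣ) := by
    refine Subgroup.isOpen_of_mem_nhds _ (g := 1) ?_
    have hcont : Continuous fun u : (v.adicCompletionIntegers K)ˣ ↦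
        ((u : v.adicCompletionIntegers K) : v.adicCompletion K) :=
      continuous_subtype_val.comp Units.continuous_val
    refine Filter.mem_of_superset (hcont.continuousAt.preimage_mem_nhds (x := 1)
      (hmap ▸ Filter.image_mem_map hU)) ?_
    rintro u ⟨z, hz, hzu⟩
    have hz1 : Valued.v z = 1 := by
      rw [← sub_sub_cancel 1 z, Valued.v.map_sub_eq_of_lt_left (by simpa using hz), map_one]
    refine ⟨(adicCompletionIntegers.isUnit_iff_valued_eq_one
      (a := ⟨z, (mem_adicCompletionIntegers _ _ _).2 hz1.le⟩)).2 hz1 |>.unit, ?_⟩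
    exact Units.ext (Subtype.ext hzu)
  have := Subgroup.quotient_finite_of_isOpen _ hopen
  exact Subgroup.finiteIndex_of_finite_quotient

end Completion

theorem valued_natCast_eq_one_of_dvd {K : Type*} [Field K] [NumberField K]
    (v : HeightOneSpectrum (𝓞 K)) {m n : ℕ} (hmn : m ∣ n) (hn : (n : 𝓞 K) ∉ v.asIdeal) :
    Valued.v (m : v.adicCompletion K) = 1 := by
  have hm : (m : 𝓞 K) ∉ v.asIdeal := fun h ↦ hn (by
    obtain ⟨k, rfl⟩ := hmn
    rw [Nat.cast_mul]
    exact Ideal.mul_mem_right _ _ h)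
  rwa [← valuation_eq_one_iff_notMem (K := K), map_natCast (algebraMap (𝓞 K) K),
    ← valued_algebraMap, map_natCast (algebraMap K (v.adicCompletion K))] at hm

/-- The value group is discrete. This is what makes a uniformizer generate the maximal ideal. -/
theorem valued_le_exp_neg_one {K : Type*} [Field K] [NumberField K]
    (v : HeightOneSpectrum (𝓞 K)) {x : v.adicCompletion K} (hx : Valued.v x < 1) :
    Valued.v x ≤ WithZero.exp (-1) := by
  rcases eq_or_ne (Valued.v x) 0 with h | h
  · rw [h]
    exact zero_le
  · rw [← WithZero.exp_log h, ← WithZero.exp_zero, WithZero.exp_lt_exp] at hx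
    rw [← WithZero.exp_log h, WithZero.exp_le_exp]
    omega

/-! ### The local extension at a finite place and its norm on units -/

section Extension

variable {K L : Type*} [Field K] [NumberField K] [Field L] [NumberField L] [Algebra K L]
  (v : HeightOneSpectrum (𝓞 K)) (w : HeightOneSpectrum (𝓞 L)) [w.asIdeal.LiesOver v.asIdeal]

theorem valued_finiteCompletionMap (x : v.adicCompletion K) :
    Valued.v (finiteCompletionMap v w x) =
      Valued.v x ^ v.asIdeal.ramificationIdx' w.asIdeal := by
  rcases eq_or_ne x 0 with rfl | hx
  · rw [map_zero, map_zero, map_zero, zero_pow]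
    exact Ideal.IsDedekindDomain.ramificationIdx'_ne_zero_of_liesOver w.asIdeal v.ne_bot
  have hx' : finiteCompletionMap v w x ≠ 0 := (map_ne_zero _).2 hx
  have h1 := isOpen_setOf_valued_sub_lt v x (γ := Valued.v x) (by simpa using hx)
  have h2 := (isOpen_setOf_valued_sub_lt w (finiteCompletionMap v w x)
    (γ := Valued.v (finiteCompletionMap v w x)) (by simpa using hx)).preimage
    (continuous_finiteCompletionMap v w)
  -- Some `y` in `K` is so close to `x` that both have the same valuation, in `K_v` and in `L_w`;
  -- this reduces to the formula on `K`.
  obtain ⟨y, hy1, hy2⟩ := (denseRange_algebraMap K v).exists_mem_open (h1.inter h2)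
    ⟨x, by simpa [zero_lt_iff] using hx, by simpa [zero_lt_iff] using hx⟩
  have e1 := Valued.v.map_sub_eq_of_lt_right (x := x - algebraMap K _ y) (y := x) hy1
  have e2 := Valued.v.map_sub_eq_of_lt_right (x := finiteCompletionMap v w x -
    finiteCompletionMap v w (algebraMap K _ y)) (y := finiteCompletionMap v w x) hy2
  rw [sub_sub_cancel_left, Valuation.map_neg] at e1 e2
  rw [← e1, ← e2, finiteCompletionMap_algebraMap, valued_algebraMap, valued_algebraMap,
    valuation_liesOver L v w]

open scoped TensorProduct Valued in
/-- The local degree is at most the global degree. -/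
theorem finrank_adicCompletion_le :
    letI := finiteCompletionAlgebra v w
    finrank (v.adicCompletion K) (w.adicCompletion L) ≤ finrank K L := by
  let _ := finiteCompletionAlgebra v w
  have : ContinuousSMul (v.adicCompletion K) (w.adicCompletion L) :=
    ⟨((continuous_finiteCompletionMap v w).comp continuous_fst).mul continuous_snd⟩
  have : IsScalarTower K (v.adicCompletion K) (w.adicCompletion L) :=
    .of_algebraMap_eq fun x ↦ by
      rw [RingHom.algebraMap_toAlgebra, finiteCompletionMap_algebraMap]
      exact IsScalarTower.algebraMap_apply K L (w.adicCompletion L) x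
  have := finite_finiteCompletionAlgebra v w
  let Φ : v.adicCompletion K ⊗[K] L →ₗ[v.adicCompletion K] w.adicCompletion L :=
    (Algebra.TensorProduct.lift
      (Algebra.algHom (v.adicCompletion K) (v.adicCompletion K) (w.adicCompletion L))
      (Algebra.algHom K L (w.adicCompletion L)) (fun _ _ ↦ mul_comm ..)).toLinearMap
  have hdense : DenseRange Φ := by
    apply (w.denseRange_algebraMap L).mono
    rintro _ ⟨l, rfl⟩
    exact ⟨1 ⊗ₜ l, by simp [Φ, Algebra.algHom]⟩
  -- The image is dense, and closed as a finite-dimensional subspace.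
  have hsurj : LinearMap.range Φ = ⊤ := by
    rw [← SetLike.coe_set_eq, ← Φ.range.closed_of_finiteDimensional.closure_eq]
    exact hdense.closure_range
  rw [← finrank_top, ← hsurj, ← Module.finrank_baseChange (R := v.adicCompletion K) (M' := L)]
  exact LinearMap.finrank_range_le Φ

/-- The inclusion `O_v → O_w` of the rings of integers. -/
def finiteIntegersMap : v.adicCompletionIntegers K →+* w.adicCompletionIntegers L :=
  (finiteCompletionMap v w).restrict (v.adicCompletionIntegers K) (w.adicCompletionIntegers L)
    fun x hx ↦ by
      rw [mem_adicCompletionIntegers] at hx ⊢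
      rw [valued_finiteCompletionMap]
      exact pow_le_one' hx _

open scoped Valued in
/-- If `w` is unramified over `v` and `v` does not divide `[L : K]!`, then every unit of `O_v` is
the norm of a unit of `O_w`. -/
theorem exists_finiteLocalNorm_eq (he : v.asIdeal.ramificationIdx' w.asIdeal = 1)
    (hn : (((finrank K L).factorial : ℕ) : 𝓞 K) ∉ v.asIdeal) {u : v.adicCompletion K}
    (hu : Valued.v u = 1) :
    ∃ y : w.adicCompletion L, Valued.v y = 1 ∧ finiteLocalNorm v w y = u := by
  let _ := finiteCompletionAlgebra v w
  have : ContinuousSMul (v.adicCompletion K) (w.adicCompletion L) :=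
    ⟨((continuous_finiteCompletionMap v w).comp continuous_fst).mul continuous_snd⟩
  have := finite_finiteCompletionAlgebra v w
  let _ : Algebra (v.adicCompletionIntegers K) (w.adicCompletionIntegers L) :=
    (finiteIntegersMap v w).toAlgebra
  let _ : Algebra (v.adicCompletionIntegers K) (w.adicCompletion L) :=
    ((algebraMap (w.adicCompletionIntegers L) (w.adicCompletion L)).comp
      (finiteIntegersMap v w)).toAlgebra
  have : IsScalarTower (v.adicCompletionIntegers K) (w.adicCompletionIntegers L)
      (w.adicCompletion L) := .of_algebraMap_eq fun _ ↦ rfl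
  have : IsScalarTower (v.adicCompletionIntegers K) (v.adicCompletion K)
      (w.adicCompletion L) := .of_algebraMap_eq fun _ ↦ rfl
  have hfin : Module.Finite (v.adicCompletionIntegers K) (w.adicCompletionIntegers L) := by
    let b := finBasis (v.adicCompletion K) (w.adicCompletion L)
    have hcont : Continuous b.equivFun :=
      LinearMap.continuous_of_finiteDimensional b.equivFun.toLinearMap
    -- Scaling by a small `c` gives all of `O_w` integral coordinates, so `O_w` embeds in a finite
    -- free module over the Noetherian ring `O_v`.
    obtain ⟨c, hc0, hc⟩ := exists_valued_sub_le_subset w (x := 0)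
      (s := b.equivFun ⁻¹' Set.univ.pi fun _ ↦ (v.adicCompletionIntegers K : Set _)) <| by
        refine hcont.continuousAt.preimage_mem_nhds ?_
        rw [map_zero]
        exact set_pi_mem_nhds Set.finite_univ fun _ _ ↦
          (Valued.isOpen_valuationSubring _).mem_nhds (zero_mem _)
    have hmem (y : w.adicCompletionIntegers L) (i) :
        b.equivFun (c * y) i ∈ v.adicCompletionIntegers K := by
      refine hc _ ?_ i trivial
      rw [sub_zero, map_mul]
      exact mul_le_of_le_one_right' ((mem_adicCompletionIntegers _ _ _).1 y.2)
    let f : w.adicCompletionIntegers L →ₗ[v.adicCompletionIntegers K]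
        (Fin (finrank (v.adicCompletion K) (w.adicCompletion L)) → v.adicCompletionIntegers K) :=
      { toFun y i := ⟨b.equivFun (c * y) i, hmem y i⟩
        map_add' x y := funext fun i ↦ Subtype.ext <| by
          simp [mul_add]
        map_smul' a y := funext fun i ↦ Subtype.ext <| by
          have : c * ((a • y : w.adicCompletionIntegers L) : w.adicCompletion L) =
              (a : v.adicCompletion K) • (c * (y : w.adicCompletion L)) :=
            mul_left_comm _ _ _
          simp [this] }
    refine Module.Finite.of_injective f fun x y h ↦ Subtype.ext ?_
    refine mul_left_cancel₀ hc0 (b.equivFun.injective (funext fun i ↦ ?_))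
    exact congrArg Subtype.val (congrFun h i)
  have hinj : Function.Injective (algebraMap (v.adicCompletionIntegers K)
      (w.adicCompletionIntegers L)) := fun x y h ↦
    Subtype.ext ((finiteCompletionMap v w).injective (congrArg Subtype.val h))
  have : Module.IsTorsionFree (v.adicCompletionIntegers K) (w.adicCompletionIntegers L) := by
    have : FaithfulSMul (v.adicCompletionIntegers K) (w.adicCompletionIntegers L) :=
      (faithfulSMul_iff_algebraMap_injective _ _).2 hinj
    infer_instance
  have : Module.Free (v.adicCompletionIntegers K) (w.adicCompletionIntegers L) := inferInstance
  have hloc := IsIntegralClosure.isLocalization (v.adicCompletionIntegers K) (v.adicCompletion K)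
    (w.adicCompletion L) (w.adicCompletionIntegers L)
  have hrank : finrank (v.adicCompletionIntegers K) (w.adicCompletionIntegers L) =
      finrank (v.adicCompletion K) (w.adicCompletion L) := by
    rw [finrank_eq_card_chooseBasisIndex, finrank_eq_card_basis
      ((Free.chooseBasis (v.adicCompletionIntegers K)
        (w.adicCompletionIntegers L)).localizationLocalization (v.adicCompletion K)
          (nonZeroDivisors (v.adicCompletionIntegers K)) (w.adicCompletion L))]
  -- As the ramification index is `1`, a uniformizer of `K_v` remains one in `L_w`.
  have hmax : (maximalIdeal (v.adicCompletionIntegers K)).map (algebraMap _ _) =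
      maximalIdeal (w.adicCompletionIntegers L) := by
    obtain ⟨p, hp⟩ := valuedAdicCompletion_surjective K v (WithZero.exp (-1))
    have hval (x : v.adicCompletionIntegers K) :
        Valued.v (algebraMap _ (w.adicCompletionIntegers L) x : w.adicCompletion L) =
          Valued.v (x : v.adicCompletion K) := by
      refine (valued_finiteCompletionMap v w x).trans ?_
      rw [he, pow_one]
    have hp1 : Valued.v p < 1 := by
      rw [hp, ← WithZero.exp_zero, WithZero.exp_lt_exp]
      norm_num
    let q : v.adicCompletionIntegers K := ⟨p, (mem_adicCompletionIntegers _ _ _).2 hp1.le⟩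
    have hq : q ∈ maximalIdeal (v.adicCompletionIntegers K) :=
      (mem_maximalIdeal_adicCompletionIntegers_iff v q).2 hp1
    refine le_antisymm (Ideal.map_le_iff_le_comap.2 fun x hx ↦ ?_) fun x hx ↦ ?_
    · rw [Ideal.mem_comap, mem_maximalIdeal_adicCompletionIntegers_iff, hval]
      exact (mem_maximalIdeal_adicCompletionIntegers_iff v x).1 hx
    · rw [mem_maximalIdeal_adicCompletionIntegers_iff] at hx
      refine Ideal.mem_of_dvd _ ?_ (Ideal.mem_map_of_mem _ hq)
      refine (adicCompletionIntegers.integers L w).dvd_of_le ?_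
      change Valued.v (x : w.adicCompletion L) ≤
        Valued.v (algebraMap _ (w.adicCompletionIntegers L) q : w.adicCompletion L)
      rw [hval]
      change _ ≤ Valued.v p
      rw [hp]
      exact valued_le_exp_neg_one w hx
  obtain ⟨y, hy, hyu⟩ := exists_norm_eq_of_unramified (R := v.adicCompletionIntegers K)
    (S := w.adicCompletionIntegers L) hmax (by
      rw [hrank, adicCompletionIntegers.isUnit_iff_valued_eq_one]
      -- The factorial appears because the local degree is only known to be at most `[L : K]`.
      have hdvd := Nat.dvd_factorial finrank_pos (finrank_adicCompletion_le v w)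
      exact valued_natCast_eq_one_of_dvd v hdvd hn)
      (u := ⟨u, (mem_adicCompletionIntegers _ _ _).2 hu.le⟩)
      (adicCompletionIntegers.isUnit_iff_valued_eq_one.2 hu)
  refine ⟨y, adicCompletionIntegers.isUnit_iff_valued_eq_one.1 hy, ?_⟩
  have := Algebra.norm_localization (v.adicCompletionIntegers K)
    (nonZeroDivisors (v.adicCompletionIntegers K)) (Rₘ := v.adicCompletion K)
    (Sₘ := w.adicCompletion L) y
  rw [hyu] at this
  exact this

end Extension

/-! ### Ramified places, and norms at the bad places -/

section FinitePlaces

variable {K L : Type*} [Field K] [NumberField K] [Field L] [NumberField L] [Algebra K L]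

-- A prime with ramification index different from `1` divides the different, a nonzero ideal with
-- finitely many prime factors.
variable (K L) in
theorem finite_setOf_ramified : {v : HeightOneSpectrum (𝓞 K) | ∃ w : HeightOneSpectrum (𝓞 L),
    w.asIdeal.LiesOver v.asIdeal ∧ v.asIdeal.ramificationIdx' w.asIdeal ≠ 1}.Finite := by
  have hd : differentIdeal (𝓞 K) (𝓞 L) ≠ ⊥ := differentIdeal_ne_bot
  refine ((Ideal.finite_factors hd).image fun w ↦ w.under (𝓞 K)).subset ?_
  rintro v ⟨w, hw, he⟩
  refine ⟨w, ?_, HeightOneSpectrum.ext hw.over.symm⟩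
  have hle : v.asIdeal.map (algebraMap (𝓞 K) (𝓞 L)) ≤ w.asIdeal := by
    rw [Ideal.map_le_iff_le_comap]
    exact hw.over.le
  have h2 : v.asIdeal.map (algebraMap (𝓞 K) (𝓞 L)) ≤ w.asIdeal ^ 2 := by
    by_contra h
    exact he (Ideal.ramificationIdx'_spec (by simpa using hle) (by simpa using h))
  have := v.isMaximal
  have := w.isPrime
  have h := pow_sub_one_dvd_differentIdeal (𝓞 K) w.asIdeal 2 v.ne_bot (Ideal.dvd_iff_le.2 h2)
  simpa using h

theorem exists_liesOver {L : Type*} [Field L] [Algebra K L] (v : HeightOneSpectrum (𝓞 K)) :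
    ∃ w : HeightOneSpectrum (𝓞 L), w.asIdeal.LiesOver v.asIdeal := by
  have := v.isMaximal
  obtain ⟨P, hP, hPv⟩ := Ideal.exists_ideal_over_maximal_of_isIntegral (S := 𝓞 L) v.asIdeal (by
    rw [(RingHom.injective_iff_ker_eq_bot _).1 (FaithfulSMul.algebraMap_injective (𝓞 K) (𝓞 L))]
    exact bot_le)
  have hlies : P.LiesOver v.asIdeal := ⟨hPv.symm⟩
  exact ⟨⟨P, hP.isPrime, Ideal.ne_bot_of_liesOver_of_ne_bot v.ne_bot P⟩, hlies⟩

variable (v : HeightOneSpectrum (𝓞 K)) (w : HeightOneSpectrum (𝓞 L))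
  [w.asIdeal.LiesOver v.asIdeal]

/-- The `[L : K]!`-th powers of units of `O_v` are norms of units of `O_w`. -/
theorem exists_finiteLocalNorm_eq_pow {z : v.adicCompletion K} (hz : Valued.v z = 1) :
    ∃ y : w.adicCompletion L, Valued.v y = 1 ∧
      finiteLocalNorm v w y = z ^ (finrank K L).factorial := by
  let _ := finiteCompletionAlgebra v w
  have := finite_finiteCompletionAlgebra v w
  obtain ⟨k, hk⟩ := Nat.dvd_factorial finrank_pos (finrank_adicCompletion_le v w)
  -- With `d` the local degree and `d * k = [L : K]!`, the norm of `z ^ k` is `z ^ (d * k)`.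
  refine ⟨finiteCompletionMap v w z ^ k, ?_, ?_⟩
  · rw [map_pow, valued_finiteCompletionMap, hz, one_pow, one_pow]
  · have h : finiteLocalNorm v w (finiteCompletionMap v w z) =
        z ^ finrank (v.adicCompletion K) (w.adicCompletion L) :=
      Algebra.norm_algebraMap z
    rw [map_pow, h, hk, pow_mul]

end FinitePlaces

/-! ### Squares and norms at the infinite places -/

section InfinitePlaces

theorem finiteIndex_range_powMonoidHom_two {F : Type*} [Field F]
    (h : ∀ x : F, IsSquare x ∨ IsSquare (-x)) :
    (powMonoidHom 2 : Fˣ →* Fˣ).range.FiniteIndex := by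
  have key (x : Fˣ) (hx : IsSquare (x : F)) : x ∈ (powMonoidHom 2 : Fˣ →* Fˣ).range := by
    obtain ⟨r, hr⟩ := hx
    have hr0 : r ≠ 0 := by
      rintro rfl
      simp at hr
    exact ⟨Units.mk0 r hr0, Units.ext (by simp [hr, sq])⟩
  have hdvd : (powMonoidHom 2 : Fˣ →* Fˣ).range.index ∣ 2 := by
    rw [Subgroup.index_dvd_two_iff]
    -- The class of `-1` is the only possible nontrivial coset of the squares.
    refine ⟨-1, fun b ↦ ?_⟩
    rcases h b with hb | hb
    · exact Or.inr (key b hb)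
    · exact Or.inl (key _ (by simpa using hb))
  exact ⟨fun h0 ↦ by simp [h0] at hdvd⟩

theorem isSquare_or_isSquare_neg {K : Type*} [Field K] (v : InfinitePlace K) (x : v.Completion) :
    IsSquare x ∨ IsSquare (-x) := by
  rcases v.isReal_or_isComplex with hv | hv
  · let e := InfinitePlace.Completion.ringEquivRealOfIsReal hv
    rcases le_total 0 (e x) with h | h
    · left
      have := (Real.isSquare_iff.2 h).map e.symm
      simpa using this
    · right
      have := (Real.isSquare_iff.2 (neg_nonneg.2 h)).map e.symm
      simpa using this
  · left
    let e := InfinitePlace.Completion.ringEquivComplexOfIsComplex hv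
    obtain ⟨r, hr⟩ := IsAlgClosed.exists_eq_mul_self (e x)
    have := IsSquare.map e.symm (a := e x) ⟨r, hr⟩
    simpa using this

variable {K L : Type*} [Field K] [NumberField K] [Field L] [NumberField L] [Algebra K L]

theorem exists_infinitePlace_liesOver (v : InfinitePlace K) :
    ∃ w : InfinitePlace L, w.LiesOver v := by
  obtain ⟨w, rfl⟩ := InfinitePlace.comap_surjective (K := L) v
  exact ⟨w, ⟨rfl⟩⟩

-- The local degree divides `w.mult`, hence `2`, so a suitable power of `z` has norm `z ^ 2`.
open scoped NumberField.LiesOver in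
theorem exists_infiniteLocalNorm_eq_sq {K L : Type*} [Field K] [Field L] [Algebra K L]
    (v : InfinitePlace K) (w : InfinitePlace L) [w.LiesOver v]
    {z : v.Completion} (hz : z ≠ 0) :
    ∃ y : w.Completion, y ≠ 0 ∧ infiniteLocalNorm v w y = z ^ 2 := by
  have hdvd : finrank v.Completion w.Completion ∣ 2 := by
    have h := InfinitePlace.mult_mul_finrank v w
    have hw : w.mult ∣ 2 := by
      rcases w.isReal_or_isComplex with hw | hw
      · simp [InfinitePlace.mult, hw]
      · simp [InfinitePlace.mult, InfinitePlace.not_isReal_iff_isComplex.2 hw]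
    exact (Dvd.intro_left _ h).trans hw
  obtain ⟨k, hk⟩ := hdvd
  refine ⟨algebraMap _ _ z ^ k, pow_ne_zero _ ((map_ne_zero _).2 hz), ?_⟩
  have h : infiniteLocalNorm v w (algebraMap _ _ z) = z ^ finrank v.Completion w.Completion :=
    Algebra.norm_algebraMap z
  rw [map_pow, h, hk, pow_mul]

end InfinitePlaces

/-! ### Orders of principal fractional ideals -/

section ClassGroup

open FractionalIdeal nonZeroDivisors

variable {K : Type*} [Field K] [NumberField K]

/-- The valuation is `exp` of minus the order, whence the sign, here and in `ideleIdeal`. -/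
theorem count_spanSingleton (v : HeightOneSpectrum (𝓞 K)) {k : K} (hk : k ≠ 0) :
    count K v (spanSingleton (𝓞 K)⁰ k) = -WithZero.log (v.valuation K k) := by
  obtain ⟨a, b, hb, rfl⟩ := IsFractionRing.div_surjective (A := 𝓞 K) k
  have hb0 : b ≠ 0 := nonZeroDivisors.ne_zero hb
  have ha0 : a ≠ 0 := by
    rintro rfl
    simp at hk
  classical
  rw [count_well_defined K v (a := b) (J := Ideal.span {a}) (spanSingleton_ne_zero_iff.2 hk) (by
    rw [coeIdeal_span_singleton, spanSingleton_mul_spanSingleton, div_eq_inv_mul]), map_div₀,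
    WithZero.log_div (by simpa using ha0) (by simpa using hb0), valuation_of_algebraMap,
    valuation_of_algebraMap, intValuation_if_neg v ha0, intValuation_if_neg v hb0,
    WithZero.log_exp, WithZero.log_exp]
  ring

end ClassGroup

/-! ### Ideles modulo principal and unit ideles -/

section Ideles

open FractionalIdeal nonZeroDivisors

variable {K : Type*} [Field K] [NumberField K]

/-- The component of an idele at a finite place. -/
def finiteComponent (v : HeightOneSpectrum (𝓞 K)) : Ideles K →* (v.adicCompletion K)ˣ :=
  Units.map
    { toFun x := x.2 v
      map_one' := rfl
      map_mul' _ _ := rfl }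

/-- The component of an idele at an infinite place. -/
def infiniteComponent (v : InfinitePlace K) : Ideles K →* v.Completionˣ :=
  Units.map
    { toFun x := x.1 v
      map_one' := rfl
      map_mul' _ _ := rfl }

/-- The inclusion of the unit group of `O_v` in the multiplicative group of `K_v`. -/
def localUnits (v : HeightOneSpectrum (𝓞 K)) :
    (v.adicCompletionIntegers K)ˣ →* (v.adicCompletion K)ˣ :=
  Units.map (v.adicCompletionIntegers K).subtype.toMonoidHom

theorem mem_range_localUnits_iff {v : HeightOneSpectrum (𝓞 K)} {x : (v.adicCompletion K)ˣ} :
    x ∈ (localUnits v).range ↔ Valued.v (x : v.adicCompletion K) = 1 := by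
  constructor
  · rintro ⟨u, rfl⟩
    exact adicCompletionIntegers.isUnit_iff_valued_eq_one.1 u.isUnit
  · intro hx
    have h : IsUnit (⟨x, (mem_adicCompletionIntegers _ _ _).2 hx.le⟩ :
      v.adicCompletionIntegers K) := adicCompletionIntegers.isUnit_iff_valued_eq_one.2 hx
    exact ⟨h.unit, Units.ext rfl⟩

variable (K) in
/-- The ideles which are units at all finite places. -/
def unitIdeles : Subgroup (Ideles K) :=
  ⨅ v : HeightOneSpectrum (𝓞 K), (localUnits v).range.comap (finiteComponent v)

theorem mem_unitIdeles_iff {x : Ideles K} : x ∈ unitIdeles K ↔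
    ∀ v, Valued.v (finiteComponent v x : v.adicCompletion K) = 1 := by
  simp [unitIdeles, Subgroup.mem_iInf, -MonoidHom.mem_range, mem_range_localUnits_iff]

theorem eventually_valued_eq_one (x : Ideles K) : ∀ᶠ v : HeightOneSpectrum (𝓞 K) in
    Filter.cofinite, Valued.v (finiteComponent v x : v.adicCompletion K) = 1 :=
  (FiniteAdeleRing.isUnit_iff.1
    (x.isUnit.map (MonoidHom.snd (InfiniteAdeleRing K) (FiniteAdeleRing (𝓞 K) K)))).2

/-- The fractional ideal of an idele. -/
def ideleIdeal (x : Ideles K) : (FractionalIdeal (𝓞 K)⁰ K)ˣ :=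
  Units.mk0 (∏ᶠ v : HeightOneSpectrum (𝓞 K), (v.asIdeal : FractionalIdeal (𝓞 K)⁰ K) ^
    (-WithZero.log (Valued.v (finiteComponent v x : v.adicCompletion K)))) <|
    finprod_induction (· ≠ 0) one_ne_zero (fun _ _ ↦ mul_ne_zero) fun v ↦
      zpow_ne_zero _ (coeIdeal_ne_zero.2 v.ne_bot)

theorem count_ideleIdeal (x : Ideles K) (v : HeightOneSpectrum (𝓞 K)) :
    count K v (ideleIdeal x : FractionalIdeal (𝓞 K)⁰ K) =
      -WithZero.log (Valued.v (finiteComponent v x : v.adicCompletion K)) := by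
  refine count_finprod K v _ ?_
  filter_upwards [eventually_valued_eq_one x] with v hv
  simp [hv]

theorem inv_mul_mem_of_ideleIdeal_eq {x y : Ideles K}
    (h : ClassGroup.mk K (ideleIdeal x) = ClassGroup.mk K (ideleIdeal y)) :
    x⁻¹ * y ∈ principalIdeles K ⊔ unitIdeles K := by
  rw [← inv_mul_eq_one, ← map_inv, ← map_mul, ClassGroup.mk_eq_one_iff,
    FractionalIdeal.isPrincipal_iff] at h
  obtain ⟨k, hk⟩ := h
  rw [Units.val_mul, Units.val_inv_eq_inv_val] at hk
  have hk0 : k ≠ 0 := by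
    rintro rfl
    rw [spanSingleton_zero] at hk
    exact mul_ne_zero (inv_ne_zero (ideleIdeal x).ne_zero) (ideleIdeal y).ne_zero hk
  let κ : Ideles K := Units.map (algebraMap K (AdeleRing (𝓞 K) K)).toMonoidHom (Units.mk0 k hk0)
  have hκ (v) : (finiteComponent v κ : v.adicCompletion K) = algebraMap K _ k := rfl
  -- The ideals of `x` and `y` differ by the principal ideal `(k)`, so dividing `x⁻¹ * y` by `k`
  -- leaves order zero at every finite place.
  rw [← mul_inv_cancel_left κ (x⁻¹ * y)]
  refine Subgroup.mul_mem_sup ⟨_, rfl⟩ (mem_unitIdeles_iff.2 fun v ↦ ?_)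
  have hc := congrArg (count K v) hk
  rw [count_mul K v (inv_ne_zero (ideleIdeal x).ne_zero) (ideleIdeal y).ne_zero, count_inv,
    count_ideleIdeal, count_ideleIdeal, count_spanSingleton v hk0] at hc
  have h0 : Valued.v (finiteComponent v (κ⁻¹ * (x⁻¹ * y)) : v.adicCompletion K) ≠ 0 := by simp
  rw [← WithZero.exp_log h0, ← WithZero.exp_zero]
  congr 1
  simp only [map_mul, map_inv, Units.val_mul, Units.val_inv_eq_inv_val, map_inv₀, hκ,
    valued_algebraMap]
  rw [WithZero.log_mul (by simpa using hk0) (by simp), WithZero.log_mul (by simp) (by simp),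
    WithZero.log_inv, WithZero.log_inv]
  linarith

-- The ideal class separates cosets, and the class group is finite. Chosen representatives suffice,
-- so `ideleIdeal` need not be shown multiplicative.
variable (K) in
theorem finiteIndex_principalIdeles_sup_unitIdeles :
    (principalIdeles K ⊔ unitIdeles K).FiniteIndex := by
  have : Finite (Ideles K ⧸ (principalIdeles K ⊔ unitIdeles K)) := by
    refine Finite.of_injective
      (fun q : Ideles K ⧸ (principalIdeles K ⊔ unitIdeles K) ↦
        ClassGroup.mk K (ideleIdeal q.out)) fun q r h ↦ ?_
    rw [← q.out_eq', ← r.out_eq']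
    exact QuotientGroup.eq.2 (inv_mul_mem_of_ideleIdeal_eq h)
  exact Subgroup.finiteIndex_of_finite_quotient

end Ideles

/-! ### Assembling the local norms and bounding the index -/

section NormIndex

/-- A family of values over the image of an injective map extends by `1`. -/
theorem exists_extension_of_injective {ι κ : Type*} {F : κ → Type*} [∀ k, One (F k)] {W : ι → κ}
    (hW : Function.Injective W) {P : ∀ k, F k → Prop} {Y : ∀ i, F (W i)}
    (hY : ∀ i, P (W i) (Y i)) (h1 : ∀ k, P k 1) :
    ∃ y : ∀ k, F k, (∀ k, P k (y k)) ∧ (∀ i, y (W i) = Y i) ∧ ∀ k ∉ Set.range W, y k = 1 := by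
  -- The family is dependent, so the value at `k` is specified by transport along every equality `W
  -- i = k`; injectivity makes this consistent.
  have key (k : κ) : ∃ z : F k, P k z ∧ (∀ i, ∀ h : W i = k, h ▸ Y i = z) ∧
      (k ∉ Set.range W → z = 1) := by
    by_cases hk : k ∈ Set.range W
    · obtain ⟨i, rfl⟩ := hk
      refine ⟨Y i, hY i, fun j h ↦ ?_, fun h ↦ absurd ⟨i, rfl⟩ h⟩
      obtain rfl := hW h
      rfl
    · exact ⟨1, h1 k, fun i h ↦ absurd ⟨i, h⟩ hk, fun _ ↦ rfl⟩
  choose y hy using key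
  exact ⟨y, fun k ↦ (hy k).1, fun i ↦ ((hy (W i)).2.1 i rfl).symm, fun k ↦ (hy k).2.2⟩

variable {K L : Type*} [Field K] [NumberField K] [Field L] [NumberField L] [Algebra K L]

/-- An idele of `K` is a norm from `L` if, at every place, it is a local norm from one place above,
and a norm of a unit at the finite places. -/
theorem mem_range_ideleNorm (x : Ideles K)
    (hfin : ∀ v : HeightOneSpectrum (𝓞 K), ∃ (w : HeightOneSpectrum (𝓞 L))
      (_ : w.asIdeal.LiesOver v.asIdeal) (y : w.adicCompletion L),
      Valued.v y = 1 ∧ finiteLocalNorm v w y = finiteComponent v x)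
    (hinf : ∀ v : InfinitePlace K, ∃ (w : InfinitePlace L) (_ : w.LiesOver v) (y : w.Completion),
      y ≠ 0 ∧ infiniteLocalNorm v w y = infiniteComponent v x) :
    x ∈ (ideleNorm K L).range := by
  classical
  choose W hW Y hY1 hYN using hfin
  choose W' hW' Y' hY0' hYN' using hinf
  have hunder (v : HeightOneSpectrum (𝓞 K)) (w : HeightOneSpectrum (𝓞 L))
      (h : w.asIdeal.LiesOver v.asIdeal) : w.under (𝓞 K) = v := HeightOneSpectrum.ext h.over.symm
  have hunder' (v : InfinitePlace K) (w : InfinitePlace L)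
      (h : w.LiesOver v) : w.comap (algebraMap K L) = v := InfinitePlace.LiesOver.comap_eq w v
  have hWinj : Function.Injective W := fun v v' h ↦ by
    rw [← hunder v _ (hW v), ← hunder v' _ (hW v'), h]
  have hWinj' : Function.Injective W' := fun v v' h ↦ by
    rw [← hunder' v _ (hW' v), ← hunder' v' _ (hW' v'), h]
  obtain ⟨y, hy1, hyW, hyone⟩ := exists_extension_of_injective hWinj
    (P := fun w (z : w.adicCompletion L) ↦ Valued.v z = 1) hY1 (fun w ↦ map_one _)
  obtain ⟨y', hy0', hyW', hyone'⟩ := exists_extension_of_injective hWinj'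
    (P := fun w (z : w.Completion) ↦ z ≠ 0) hY0' (fun w ↦ one_ne_zero)
  have hyne (v : HeightOneSpectrum (𝓞 K)) (w : HeightOneSpectrum (𝓞 L))
      (h : w.asIdeal.LiesOver v.asIdeal) (hne : w ≠ W v) : y w = 1 := by
    refine hyone w ?_
    rintro ⟨v', rfl⟩
    rw [← hunder v _ h, hunder v' _ (hW v')] at hne
    exact hne rfl
  have hyne' (v : InfinitePlace K) (w : InfinitePlace L) (h : w.LiesOver v) (hne : w ≠ W' v) :
      y' w = 1 := by
    refine hyone' w ?_
    rintro ⟨v', rfl⟩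
    rw [← hunder' v _ h, hunder' v' _ (hW' v')] at hne
    exact hne rfl
  let yf : FiniteAdeleRing (𝓞 L) L :=
    ⟨y, Filter.Eventually.of_forall fun w ↦ (mem_adicCompletionIntegers _ _ _).2 (hy1 w).le⟩
  have hyf : IsUnit yf := FiniteAdeleRing.isUnit_iff.2
    ⟨fun w h ↦ by simpa [show y w = 0 from h] using hy1 w, Filter.Eventually.of_forall hy1⟩
  have hyi : IsUnit (y' : InfiniteAdeleRing L) :=
    Pi.isUnit_iff.2 fun w ↦ (hy0' w).isUnit
  have hu : IsUnit ((y', yf) : AdeleRing (𝓞 L) L) := Prod.isUnit_iff.2 ⟨hyi, hyf⟩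
  refine ⟨hu.unit, Units.ext (Prod.ext (funext fun v ↦ ?_) (FiniteAdeleRing.ext K fun v ↦ ?_))⟩
  · refine (Fintype.prod_eq_single (⟨W' v, hW' v⟩ : {w : InfinitePlace L // w.LiesOver v})
      fun w hw ↦ ?_).trans ?_
    · have := w.2
      change infiniteLocalNorm v w.1 (y' w.1) = 1
      rw [hyne' v w.1 w.2 fun h ↦ hw (Subtype.ext h), map_one]
    · have := hW' v
      change infiniteLocalNorm v (W' v) (y' (W' v)) = _
      rw [hyW', hYN']
      rfl
  · refine (Fintype.prod_eq_single (⟨W v, hW v⟩ :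
      {w : HeightOneSpectrum (𝓞 L) // w.asIdeal.LiesOver v.asIdeal}) fun w hw ↦ ?_).trans ?_
    · have := w.2
      change finiteLocalNorm v w.1 (y w.1) = 1
      rw [hyne v w.1 w.2 fun h ↦ hw (Subtype.ext h), map_one]
    · have := hW v
      change finiteLocalNorm v (W v) (y (W v)) = _
      rw [hyW, hYN]
      rfl

variable (K L)

/-- The finite places of `K` which are ramified in `L` or divide `[L : K]!`. -/
def badPlaces : Set (HeightOneSpectrum (𝓞 K)) :=
  {v | ∃ w : HeightOneSpectrum (𝓞 L),
    w.asIdeal.LiesOver v.asIdeal ∧ v.asIdeal.ramificationIdx' w.asIdeal ≠ 1} ∪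
  {v | (((finrank K L).factorial : ℕ) : 𝓞 K) ∈ v.asIdeal}

theorem finite_badPlaces : (badPlaces K L).Finite := by
  refine (finite_setOf_ramified K L).union ?_
  have h : Ideal.span {(((finrank K L).factorial : ℕ) : 𝓞 K)} ≠ 0 := by
    simp [Nat.factorial_ne_zero]
  refine (Ideal.finite_factors h).subset fun v hv ↦ ?_
  exact Ideal.dvd_span_singleton.2 hv

/-- The unit ideles which are `[L : K]!`-th powers of units at the bad places and squares at the
infinite places. -/
def powerIdeles : Subgroup (Ideles K) :=
  unitIdeles K ⊓
    ((⨅ v : badPlaces K L, ((powMonoidHom (finrank K L).factorial).range.map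
      (localUnits v.1)).comap (finiteComponent v.1)) ⊓
    ⨅ v : InfinitePlace K, (powMonoidHom 2).range.comap (infiniteComponent v))

/-- Only finitely many local conditions are imposed, each of finite index. -/
theorem relIndex_powerIdeles_ne_zero : (powerIdeles K L).relIndex (unitIdeles K) ≠ 0 := by
  have := (finite_badPlaces K L).to_subtype
  refine Subgroup.relIndex_inf_ne_zero (by simp) (Subgroup.relIndex_inf_ne_zero ?_ ?_)
  · refine Subgroup.relIndex_iInf_ne_zero fun v ↦ ?_
    refine mt (Subgroup.relIndex_eq_zero_of_le_right (iInf_le _ v.1))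
      (Subgroup.relIndex_comap_ne_zero _ ?_)
    rw [MonoidHom.range_eq_map (localUnits v.1), Subgroup.relIndex_map_map_of_injective,
      Subgroup.relIndex_top_right]
    · exact (finiteIndex_range_powMonoidHom v.1 (Nat.factorial_ne_zero _)).index_ne_zero
    · exact Units.map_injective Subtype.val_injective
  · refine Subgroup.relIndex_iInf_ne_zero fun v ↦ ?_
    refine mt (Subgroup.relIndex_eq_zero_of_le_right le_top)
      (Subgroup.relIndex_comap_ne_zero (K := ⊤) _ ?_)
    rw [Subgroup.relIndex_top_right]
    exact (finiteIndex_range_powMonoidHom_two (isSquare_or_isSquare_neg v)).index_ne_zero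

theorem powerIdeles_le_range_ideleNorm : powerIdeles K L ≤ (ideleNorm K L).range := by
  rintro x ⟨hu, hf, hi⟩
  replace hu := mem_unitIdeles_iff.1 hu
  replace hf := Subgroup.mem_iInf.1 hf
  replace hi := Subgroup.mem_iInf.1 hi
  refine mem_range_ideleNorm x (fun v ↦ ?_) fun v ↦ ?_
  · obtain ⟨w, hw⟩ := exists_liesOver (L := L) v
    refine ⟨w, hw, ?_⟩
    by_cases hv : v ∈ badPlaces K L
    · obtain ⟨_, ⟨z, rfl⟩, hz⟩ := hf ⟨v, hv⟩
      obtain ⟨y, hy, hyz⟩ := exists_finiteLocalNorm_eq_pow v w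
        (z := (z : v.adicCompletionIntegers K))
        (adicCompletionIntegers.isUnit_iff_valued_eq_one.1 z.isUnit)
      exact ⟨y, hy, hyz.trans (congrArg Units.val hz)⟩
    · simp only [badPlaces, Set.mem_union, not_or, Set.mem_ofPred_eq, not_exists, not_and,
        not_not] at hv
      exact exists_finiteLocalNorm_eq v w (hv.1 w hw) hv.2 (hu v)
  · obtain ⟨w, hw⟩ := exists_infinitePlace_liesOver (L := L) v
    obtain ⟨z, hz⟩ := hi v
    obtain ⟨y, hy, hyz⟩ := exists_infiniteLocalNorm_eq_sq v w z.ne_zero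
    exact ⟨w, hw, y, hy, hyz.trans (congrArg Units.val hz)⟩

theorem finiteIndex_normSubgroup : (normSubgroup K L).FiniteIndex := by
  have h1 := (finiteIndex_principalIdeles_sup_unitIdeles K).index_ne_zero
  have h2 : (normSubgroup K L).relIndex (unitIdeles K) ≠ 0 := fun h ↦
    relIndex_powerIdeles_ne_zero K L (Subgroup.relIndex_eq_zero_of_le_left
      ((powerIdeles_le_range_ideleNorm K L).trans le_sup_right) h)
  -- Enlarge `K^* U` to `H U`, where `[H U : H] = [U : H ∩ U]`.
  have h3 : (normSubgroup K L).relIndex (principalIdeles K ⊔ unitIdeles K) ≠ 0 := by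
    refine mt (Subgroup.relIndex_eq_zero_of_le_right
      (sup_le_sup_right (le_sup_left : _ ≤ normSubgroup K L) _)) ?_
    rw [sup_comm]
    exact (Subgroup.relIndex_sup_right (unitIdeles K) (normSubgroup K L)).trans_ne h2
  rw [← Subgroup.relIndex_top_right] at h1
  have h4 := Subgroup.relIndex_ne_zero_trans h3 h1
  rw [Subgroup.relIndex_top_right] at h4
  exact ⟨h4⟩

end NormIndex

end NormIndex

end

theorem mainTheorem2 (K L : Type*) [Field K] [NumberField K] [Field L] [NumberField L]
    [Algebra K L] [IsGalois K L] [IsCyclic (L ≃ₐ[K] L)] :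
    (NormIndex.normSubgroup K L).FiniteIndex :=
  NormIndex.finiteIndex_normSubgroup K L
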